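/- **Model.** An asynchronous message-passing system has $n$ servers $s_1,\dots,s_n$, arbitrarily many readers, and one writer, who is also the auditor. The writer can only fail by crashing; at most $f$ servers and any number of readers are Byzantine. A correct process follows the algorithm below and never stops. Point-to-point channels are authenticated, private and reliable between correct processes. The writer broadcasts to the servers by reliable broadcast: a correct server delivers a message only if it was broadcast, and at most once; if the writer is correct, or if some correct server delivers the message, then all correct servers eventually deliver it. Cryptography is ideal: nobody forges a signature of a correct process; for the write of $v$ with timestamp $ts$ the writer generates genuine blocks $b_1,\dots,b_n$, which nobody else can fabricate, $b_i$ being encrypted so that only $s_i$ can decrypt it; $\tau$ different blocks are necessary and sufficient to reconstruct $v$. Byzantine processes are otherwise arbitrary, except that a Byzantine reader does not cooperate: it hands no genuine block to another faulty process. **Algorithm.** - *write*$(v)$: the writer increments its timestamp $ts$, broadcasts $(ts,[b_1,\dots,b_n])$, and returns after $n-f$ acknowledgements for $ts$ from different servers. A server that delivers this message stores its decrypted block as $val[ts]$, sets $reg\_ts:=\max(reg\_ts,ts)$ and acknowledges $ts$. - *read*: reader $p$ increments its sequence number $q$, which tags all messages of this read, resets its other variables and asks all servers for timestamps; a server answers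 with $reg\_ts$. The timestamps received from $s_i$ are collected in a set $C_i$. Whenever such an answer arrives and at least $n-f$ of the $C_i$ are nonempty, $p$ sets $min\_ts$ to the least collected timestamp $x$ such that $\min C_i\le x$ for at least $2f+1$ indices $i$, and sends a value request for $min\_ts$ to all servers; a server answers it with the same timestamp, which $p$ adds to $C_i$, once its $reg\_ts$ is at least that timestamp. When $min\_ts$ is in at least $f+1$ of the sets $C_i$, $p$ sends to all servers a block request containing the record $(p,min\_ts,q)$ signed by $p$. A server that receives from $p$ a record $(p,ts,q)$ signed by $p$ waits until $reg\_ts\ge ts$ and (if $ts>0$) the block $val[ts]$ has arrived; it then adds the signed record to its log and sends $val[ts]$ to $p$. The read returns the value $v$ with the highest timestamp $ts$ for which $\tau$ different blocks have been collected, once $\min C_i\le ts$ for at least $2f+1$ indices $i$. - *audit*: the writer sends an audit request to all servers; a server answers with its current log. After answers to this audit from at least $n-f$ servers, the writer returns the set $E_A$ of all records that carry a valid signature of the reader they name and occur in at least $t$ of the collected logs. The writer executes one operation at a time, and each reader one read at a time. **Definitions.** A reader $p$ has *effectively read* $v$ at some time if a $write(v)$ has been invoked and $p$ has received, in messages from servers,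 $\tau$ different genuine blocks of that write. An audit *reports* that $p$ has read $v$ if its response $E_A$ contains a record $(p,ts,q)$ where $ts$ is the timestamp of a $write(v)$. **Theorem.** Let $n=3f+1$, $\tau=2f+1$ and $t=1$. Then every execution of the algorithm satisfies strong auditability, that is: 1. *Completeness.* If a reader $p$, correct or Byzantine, has effectively read $v$ before the invocation of an audit operation, then that audit reports that $p$ has read $v$: every response of it does so, and it has a response if the writer does not crash. 2. *Strong accuracy.* If a correct reader $p$ never effectively reads $v$ in the execution, then no audit reports that $p$ has read $v$. -/

import Mathlib

namespace AuditableRegister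

universe u v

/-- The processes: the `n` servers, the readers (clients indexed by `R`), and the writer, who is
also the auditor. -/
inductive Proc (n : ℕ) (R : Type u) : Type u
  | server (i : Fin n)
  | reader (r : R)
  | writer

/-- Symbolic blocks. `share w ts i` is the genuine (decrypted) `i`-th block of the value `w` written
with timestamp `ts`; `junk` is any altered or fabricated block (recognised as invalid thanks to the
fingerprints). -/
inductive Block (n : ℕ) (V : Type v) : Type v
  | share (w : V) (ts : ℕ) (i : Fin n)
  | junk

/-- A block encrypted with the public key of the server `key`. -/
structure EncBlock (n : ℕ) (V : Type v) where
  key : Fin n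
  block : Block n V

/-- Server `i` can decrypt exactly the blocks encrypted with its own key. -/
def decrypt {n : ℕ} {V : Type v} (i : Fin n) (c : EncBlock n V) : Option (Block n V) :=
  if c.key = i then some c.block else none

/-- `GenerateBlocks`: the `i`-th block is encrypted for server `i`. -/
def generateBlocks {n : ℕ} {V : Type v} (w : V) (ts : ℕ) : Fin n → EncBlock n V :=
  fun i => ⟨i, .share w ts i⟩

/-- The `WRITE` message that the writer broadcasts. -/
structure WriteMsg (n : ℕ) (V : Type v) where
  ts : ℕ
  blocks : Fin n → EncBlock n V

/-- A log record `(reader, ts, seq)` carrying the signature of the process `signer`. -/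
structure Record (n : ℕ) (R : Type u) where
  reader : R
  ts : ℕ
  seq : ℕ
  signer : Proc n R

/-- The record is signed by the reader that it names. -/
def Record.Valid {n : ℕ} {R : Type u} (x : Record n R) : Prop := x.signer = .reader x.reader

/-- Point-to-point messages. `auditReq` and `auditResp` carry the number of the audit operation
that they belong to, just as the messages of a read carry its sequence number. -/
inductive Msg (n : ℕ) (V : Type v) (R : Type u) : Type (max u v)
  | writeAck (ts : ℕ)
  | tsReq (seq : ℕ)
  | tsResp (ts seq : ℕ)
  | valReq (ts seq : ℕ)
  | valResp (ts seq : ℕ)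
  | blockReq (x : Record n R)
  | blockResp (b : Option (Block n V)) (ts seq : ℕ)
  | auditReq (k : ℕ)
  | auditResp (k : ℕ) (log : Set (Record n R))

/-- The blocks contained in a message. -/
def Msg.blocks {n : ℕ} {V : Type v} {R : Type u} : Msg n V R → Set (Block n V)
  | .blockResp (some b) _ _ => {b}
  | _ => ∅

/-- The signed records contained in a message. -/
def Msg.records {n : ℕ} {V : Type v} {R : Type u} : Msg n V R → Set (Record n R)
  | .blockReq x => {x}
  | .auditResp _ log => log
  | _ => ∅

/-- A message in transit, with its authenticated sender and its destination. -/
structure Packet (n : ℕ) (V : Type v) (R : Type u) where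
  src : Proc n R
  dst : Proc n R
  msg : Msg n V R

/-- One copy of `m` from `src` to every server. -/
def sendAll {n : ℕ} {V : Type v} {R : Type u} (src : Proc n R) (m : Msg n V R) :
    Multiset (Packet n V R) :=
  (Finset.univ : Finset (Fin n)).val.map fun i => ⟨src, .server i, m⟩

/-- The parameters of the system: resilience `f`, number `tau` of blocks needed to reconstruct a
value, report threshold `t`, and the set of Byzantine processes. The writer is not Byzantine (it can
only crash), at most `f` servers and any number of readers are Byzantine. -/
structure System (n : ℕ) (R : Type u) where
  f : ℕ
  tau : ℕ
  t : ℕ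
  byz : Set (Proc n R)
  writer_not_byz : Proc.writer ∉ byz
  byz_servers_le : {i : Fin n | Proc.server i ∈ byz}.ncard ≤ f

/-! ### Servers -/

structure ServerState (n : ℕ) (V : Type v) (R : Type u) where
  regTs : ℕ
  /-- `val ts` is the stored block with timestamp `ts`, if any. -/
  val : ℕ → Option (Block n V)
  log : Set (Record n R)
  /-- `VAL_REQ`s received and not answered yet: reader, timestamp, sequence number. -/
  pendingVal : Multiset (R × ℕ × ℕ)
  /-- `BLOCK_REQ`s received and not answered yet. -/
  pendingBlock : Multiset (Record n R)

def ServerState.init (n : ℕ) (V : Type v) (R : Type u) : ServerState n V R :=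
  ⟨0, fun _ => none, ∅, 0, 0⟩

/-- Delivery of a broadcast `WRITE` message at server `i` (an acknowledgement is sent as well). -/
def ServerState.deliver {n : ℕ} {V : Type v} {R : Type u} (i : Fin n) (s : ServerState n V R)
    (m : WriteMsg n V) : ServerState n V R :=
  { s with
    val := Function.update s.val m.ts (decrypt i (m.blocks i))
    regTs := if s.regTs < m.ts then m.ts else s.regTs }

open Classical in
/-- Reception of a point-to-point message at a correct server `i`: new state and messages sent.
Messages that match no clause of the protocol are ignored. -/
noncomputable def ServerState.recv {n : ℕ} {V : Type v} {R : Type u} (i : Fin n)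
    (s : ServerState n V R) (src : Proc n R) (m : Msg n V R) :
    ServerState n V R × Multiset (Packet n V R) :=
  match src, m with
  | .reader r, .tsReq seq => (s, {⟨.server i, .reader r, .tsResp s.regTs seq⟩})
  | .reader r, .valReq ts seq => ({ s with pendingVal := (r, ts, seq) ::ₘ s.pendingVal }, 0)
  | .reader r, .blockReq x =>
      if x.reader = r ∧ x.Valid then ({ s with pendingBlock := x ::ₘ s.pendingBlock }, 0)
      else (s, 0)
  | .writer, .auditReq k => (s, {⟨.server i, .writer, .auditResp k s.log⟩})
  | _, _ => (s, 0)

/-- The condition a server waits for before it logs and answers a `BLOCK_REQ` for timestamp `ts`: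
its timestamp has reached `ts` and it has received the block with timestamp `ts` (there is no
block to wait for when `ts = 0`). -/
def ServerState.Ready {n : ℕ} {V : Type v} {R : Type u} (s : ServerState n V R) (ts : ℕ) : Prop :=
  ts ≤ s.regTs ∧ (ts = 0 ∨ (s.val ts).isSome)

/-! ### Readers -/

inductive ReaderPhase
  | idle
  /-- waiting for `f + 1` occurrences of `min_ts` -/
  | timestamps
  /-- waiting for the blocks -/
  | blocks

structure ReaderState (n : ℕ) (V : Type v) where
  phase : ReaderPhase
  seq : ℕ
  collTs : Fin n → Set ℕ
  collBlocks : Fin n → Set (Option (Block n V) × ℕ)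
  minTs : Option ℕ

def ReaderState.init (n : ℕ) (V : Type v) : ReaderState n V :=
  ⟨.idle, 0, fun _ => ∅, fun _ => ∅, none⟩

/-- `notOld(ts)`: for at least `2 f + 1` servers `i`, `min(Collected_ts[i]) ≤ ts`. -/
def NotOld {n : ℕ} (f : ℕ) (C : Fin n → Set ℕ) (ts : ℕ) : Prop :=
  2 * f + 1 ≤ {i | ∃ m, IsLeast (C i) m ∧ m ≤ ts}.ncard

open Classical in
/-- The least collected timestamp that is not old. -/
noncomputable def computeMinTs {n : ℕ} (f : ℕ) (C : Fin n → Set ℕ) : Option ℕ :=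
  if {ts | (∃ i, ts ∈ C i) ∧ NotOld f C ts}.Nonempty then
    some (sInf {ts | (∃ i, ts ∈ C i) ∧ NotOld f C ts})
  else none

/-- The collected blocks contain `tau` different blocks of the value `w` with timestamp `ts`. -/
def Reconstructs {n : ℕ} {V : Type v} (tau : ℕ) (C : Fin n → Set (Option (Block n V) × ℕ))
    (w : V) (ts : ℕ) : Prop :=
  tau ≤ {i : Fin n | ∃ j, (some (Block.share w ts i), ts) ∈ C j}.ncard

/-- `GetValue(C) = (w, ts)`: a value with the highest timestamp among those that can be
reconstructed. -/
def GetValue {n : ℕ} {V : Type v} (tau : ℕ) (C : Fin n → Set (Option (Block n V) × ℕ))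
    (w : V) (ts : ℕ) : Prop :=
  Reconstructs tau C w ts ∧ ∀ w' ts', Reconstructs tau C w' ts' → ts' ≤ ts

/-- Invocation of a read: the sequence number grows, all other variables are reset. -/
def ReaderState.start {n : ℕ} {V : Type v} (s : ReaderState n V) : ReaderState n V :=
  ⟨.timestamps, s.seq + 1, fun _ => ∅, fun _ => ∅, none⟩

/-- Reception of a message at a correct reader `r`: new state and messages sent. -/
noncomputable def ReaderState.recv {n : ℕ} {V : Type v} {R : Type u} (f : ℕ) (r : R)
    (s : ReaderState n V) (src : Proc n R) (m : Msg n V R) :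
    ReaderState n V × Multiset (Packet n V R) :=
  match src, m with
  | .server i, .tsResp ts num =>
      if num = s.seq then
        let C := Function.update s.collTs i (insert ts (s.collTs i))
        if n - f ≤ {j | (C j).Nonempty}.ncard then
          ({ s with collTs := C, minTs := computeMinTs f C },
            match computeMinTs f C with
            | some k => sendAll (.reader r) (.valReq k s.seq)
            | none => 0)
        else ({ s with collTs := C }, 0)
      else (s, 0)
  | .server i, .valResp ts num =>
      if num = s.seq then
        ({ s with collTs := Function.update s.collTs i (insert ts (s.collTs i)) }, 0)
      else (s, 0)
  | .server i, .blockResp b ts num =>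
      if num = s.seq then
        ({ s with collBlocks := Function.update s.collBlocks i (insert (b, ts) (s.collBlocks i)) },
          0)
      else (s, 0)
  | _, _ => (s, 0)

/-! ### The writer / auditor -/

inductive WriterPhase
  | idle
  | writing
  | auditing

structure WriterState (n : ℕ) (R : Type u) where
  phase : WriterPhase
  crashed : Prop
  ts : ℕ
  acks : Fin n → Option ℕ
  auditNo : ℕ
  /-- `Collected_log`; `none` means that no response has been received. -/
  collLog : Fin n → Option (Set (Record n R))

def WriterState.init (n : ℕ) (R : Type u) : WriterState n R :=
  ⟨.idle, False, 0, fun _ => none, 0, fun _ => none⟩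

/-- Reception of a message at the writer. -/
def WriterState.recv {n : ℕ} {V : Type v} {R : Type u} (s : WriterState n R)
    (src : Proc n R) (m : Msg n V R) : WriterState n R :=
  match src, m with
  | .server i, .writeAck ts =>
      if s.ts = ts then { s with acks := Function.update s.acks i (some ts) } else s
  | .server i, .auditResp k log =>
      if k = s.auditNo then { s with collLog := Function.update s.collLog i (some log) } else s
  | _, _ => s

/-- The result `E_A` of an audit: the correctly signed records that occur in at least `t` of the
collected logs. -/
def auditResult {n : ℕ} {R : Type u} (t : ℕ) (L : Fin n → Option (Set (Record n R))) :
    Set (Record n R) :=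
  {x | x.Valid ∧ t ≤ {k | ∃ log, L k = some log ∧ x ∈ log}.ncard}

/-! ### Global configurations, events and steps -/

structure Config (n : ℕ) (V : Type v) (R : Type u) where
  writer : WriterState n R
  server : Fin n → ServerState n V R
  reader : R → ReaderState n V
  /-- messages sent and not yet received -/
  net : Multiset (Packet n V R)
  /-- messages broadcast by the writer so far -/
  cast : Set (WriteMsg n V)
  /-- broadcast messages delivered so far by each server -/
  delivered : Fin n → Set (WriteMsg n V)
  /-- records signed so far by correct processes -/
  signed : Set (Record n R)
  /-- blocks received so far by each process in point-to-point messages -/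
  received : Proc n R → Set (Block n V)

def Config.init (n : ℕ) (V : Type v) (R : Type u) : Config n V R where
  writer := .init n R
  server := fun _ => .init n V R
  reader := fun _ => .init n V
  net := 0
  cast := ∅
  delivered := fun _ => ∅
  signed := ∅
  received := fun _ => ∅

/-- Process `p` holds the block `b`: it has received it, or it is a server that can decrypt it from
a broadcast message. -/
def Config.Holds {n : ℕ} {V : Type v} {R : Type u} (c : Config n V R) (p : Proc n R)
    (b : Block n V) : Prop :=
  b ∈ c.received p ∨
    ∃ i, p = .server i ∧ ∃ m ∈ c.cast, ∃ k, decrypt i (m.blocks k) = some b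

inductive Event (n : ℕ) (V : Type v) (R : Type u) : Type (max u v)
  /-- invocation of `write(w)`, which gets the timestamp `ts`, and broadcast of its message -/
  | invokeWrite (w : V) (ts : ℕ)
  | returnWrite (ts : ℕ)
  /-- invocation of the `k`-th audit operation -/
  | invokeAudit (k : ℕ)
  /-- response of the `k`-th audit operation -/
  | returnAudit (k : ℕ) (EA : Set (Record n R))
  /-- crash of the writer -/
  | crash
  /-- delivery of a broadcast message at server `i` -/
  | deliver (i : Fin n) (m : WriteMsg n V)
  | invokeRead (r : R)
  /-- the reader has seen `min_ts` `f + 1` times and sends its signed `BLOCK_REQ` -/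
  | requestBlocks (r : R)
  | returnRead (r : R) (w : V)
  | answerVal (i : Fin n) (r : R) (ts seq : ℕ)
  | answerBlock (i : Fin n) (x : Record n R)
  /-- reception of a point-to-point message -/
  | receive (p : Packet n V R)
  /-- a Byzantine process sends a message -/
  | byzSend (p : Packet n V R)
  /-- nothing happens -/
  | idle

/-- What a Byzantine process `p.src` can send. It sends in its own name only (channels are
authenticated), it cannot forge signatures of correct processes, it can only send genuine blocks
that it holds, and a Byzantine reader does not cooperate: it hands no genuine block to
another faulty process. -/
structure ByzCanSend {n : ℕ} {V : Type v} {R : Type u} (S : System n R) (c : Config n V R)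
    (p : Packet n V R) : Prop where
  byz : p.src ∈ S.byz
  unforgeable : ∀ x ∈ p.msg.records, x.signer ∉ S.byz → x ∈ c.signed
  holds : ∀ w ts i, Block.share w ts i ∈ p.msg.blocks → c.Holds p.src (.share w ts i)
  no_cooperation : (∃ r, p.src = .reader r) → p.dst ∈ S.byz → p.dst ≠ p.src →
    ∀ w ts i, Block.share w ts i ∉ p.msg.blocks

open Classical in
/-- The transition relation. Correct processes follow the protocol. -/
inductive Step {n : ℕ} {V : Type v} {R : Type u} (S : System n R) :
    Config n V R → Event n V R → Config n V R → Prop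
  | invokeWrite (c : Config n V R) (w : V) (hc : ¬ c.writer.crashed)
      (hp : c.writer.phase = .idle) :
      Step S c (.invokeWrite w (c.writer.ts + 1))
        { c with
          writer := { c.writer with phase := .writing, ts := c.writer.ts + 1 }
          cast := insert ⟨c.writer.ts + 1, generateBlocks w (c.writer.ts + 1)⟩ c.cast }
  | returnWrite (c : Config n V R) (hc : ¬ c.writer.crashed) (hp : c.writer.phase = .writing)
      (hacks : n - S.f ≤ {i | c.writer.acks i = some c.writer.ts}.ncard) :
      Step S c (.returnWrite c.writer.ts)
        { c with writer := { c.writer with phase := .idle } }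
  | invokeAudit (c : Config n V R) (hc : ¬ c.writer.crashed) (hp : c.writer.phase = .idle) :
      Step S c (.invokeAudit (c.writer.auditNo + 1))
        { c with
          writer := { c.writer with
            phase := .auditing
            auditNo := c.writer.auditNo + 1
            collLog := fun _ => none }
          net := c.net + sendAll .writer (.auditReq (c.writer.auditNo + 1)) }
  | returnAudit (c : Config n V R) (hc : ¬ c.writer.crashed) (hp : c.writer.phase = .auditing)
      (hlogs : n - S.f ≤ {i | c.writer.collLog i ≠ none}.ncard) :
      Step S c (.returnAudit c.writer.auditNo (auditResult S.t c.writer.collLog))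
        { c with writer := { c.writer with phase := .idle } }
  | crash (c : Config n V R) :
      Step S c .crash { c with writer := { c.writer with crashed := True } }
  | deliver (c : Config n V R) (i : Fin n) (m : WriteMsg n V) (hi : .server i ∉ S.byz)
      (hm : m ∈ c.cast) (hnew : m ∉ c.delivered i) :
      Step S c (.deliver i m)
        { c with
          server := Function.update c.server i ((c.server i).deliver i m)
          delivered := Function.update c.delivered i (insert m (c.delivered i))
          net := ⟨.server i, .writer, .writeAck m.ts⟩ ::ₘ c.net }
  | invokeRead (c : Config n V R) (r : R) (hr : .reader r ∉ S.byz)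
      (hp : (c.reader r).phase = .idle) :
      Step S c (.invokeRead r)
        { c with
          reader := Function.update c.reader r (c.reader r).start
          net := c.net + sendAll (.reader r) (.tsReq ((c.reader r).seq + 1)) }
  | requestBlocks (c : Config n V R) (r : R) (k : ℕ) (hr : .reader r ∉ S.byz)
      (hp : (c.reader r).phase = .timestamps) (hk : (c.reader r).minTs = some k)
      (hcount : S.f + 1 ≤ {i | k ∈ (c.reader r).collTs i}.ncard) :
      Step S c (.requestBlocks r)
        { c with
          reader := Function.update c.reader r { c.reader r with phase := .blocks }
          signed := insert ⟨r, k, (c.reader r).seq, .reader r⟩ c.signed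
          net := c.net +
            sendAll (.reader r) (.blockReq ⟨r, k, (c.reader r).seq, .reader r⟩) }
  | returnRead (c : Config n V R) (r : R) (w : V) (ts : ℕ) (hr : .reader r ∉ S.byz)
      (hp : (c.reader r).phase = .blocks) (hv : GetValue S.tau (c.reader r).collBlocks w ts)
      (hold : NotOld S.f (c.reader r).collTs ts) :
      Step S c (.returnRead r w)
        { c with reader := Function.update c.reader r { c.reader r with phase := .idle } }
  | answerVal (c : Config n V R) (i : Fin n) (r : R) (ts seq : ℕ)
      (rest : Multiset (R × ℕ × ℕ)) (hi : .server i ∉ S.byz)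
      (hpend : (c.server i).pendingVal = (r, ts, seq) ::ₘ rest)
      (hts : ts ≤ (c.server i).regTs) :
      Step S c (.answerVal i r ts seq)
        { c with
          server := Function.update c.server i { c.server i with pendingVal := rest }
          net := ⟨.server i, .reader r, .valResp ts seq⟩ ::ₘ c.net }
  | answerBlock (c : Config n V R) (i : Fin n) (x : Record n R)
      (rest : Multiset (Record n R)) (hi : .server i ∉ S.byz)
      (hpend : (c.server i).pendingBlock = x ::ₘ rest) (hready : (c.server i).Ready x.ts) :
      Step S c (.answerBlock i x)
        { c with
          server := Function.update c.server i
            { c.server i with pendingBlock := rest, log := insert x (c.server i).log }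
          net := ⟨.server i, .reader x.reader,
            .blockResp ((c.server i).val x.ts) x.ts x.seq⟩ ::ₘ c.net }
  | receiveServer (c : Config n V R) (i : Fin n) (src : Proc n R) (m : Msg n V R)
      (rest : Multiset (Packet n V R)) (hi : .server i ∉ S.byz)
      (hnet : c.net = ⟨src, .server i, m⟩ ::ₘ rest) :
      Step S c (.receive ⟨src, .server i, m⟩)
        { c with
          server := Function.update c.server i ((c.server i).recv i src m).1
          net := rest + ((c.server i).recv i src m).2
          received := Function.update c.received (.server i)
            (c.received (.server i) ∪ m.blocks) }
  | receiveReader (c : Config n V R) (r : R) (src : Proc n R) (m : Msg n V R)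
      (rest : Multiset (Packet n V R)) (hr : .reader r ∉ S.byz)
      (hnet : c.net = ⟨src, .reader r, m⟩ ::ₘ rest) :
      Step S c (.receive ⟨src, .reader r, m⟩)
        { c with
          reader := Function.update c.reader r ((c.reader r).recv S.f r src m).1
          net := rest + ((c.reader r).recv S.f r src m).2
          received := Function.update c.received (.reader r)
            (c.received (.reader r) ∪ m.blocks) }
  | receiveWriter (c : Config n V R) (src : Proc n R) (m : Msg n V R)
      (rest : Multiset (Packet n V R)) (hc : ¬ c.writer.crashed)
      (hnet : c.net = ⟨src, .writer, m⟩ ::ₘ rest) :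
      Step S c (.receive ⟨src, .writer, m⟩)
        { c with
          writer := c.writer.recv src m
          net := rest
          received := Function.update c.received .writer (c.received .writer ∪ m.blocks) }
  | receiveByz (c : Config n V R) (p : Packet n V R) (rest : Multiset (Packet n V R))
      (hp : p.dst ∈ S.byz) (hnet : c.net = p ::ₘ rest) :
      Step S c (.receive p)
        { c with
          net := rest
          received := Function.update c.received p.dst (c.received p.dst ∪ p.msg.blocks) }
  | byzSend (c : Config n V R) (p : Packet n V R) (hp : ByzCanSend S c p) :
      Step S c (.byzSend p) { c with net := p ::ₘ c.net }
  | idle (c : Config n V R) : Step S c .idle c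

/-- The process `p` is correct in a run with events `ev`: it is not Byzantine and does not crash
(only the writer can crash). -/
def Correct {n : ℕ} {V : Type v} {R : Type u} (S : System n R) (ev : ℕ → Event n V R)
    (p : Proc n R) : Prop :=
  p ∉ S.byz ∧ (p = .writer → ∀ T, ev T ≠ .crash)

/-- Weak fairness of a set `A` of events: if from some time on an event of `A` is always enabled,
then an event of `A` occurs after that time. -/
def WeaklyFair {n : ℕ} {V : Type v} {R : Type u} (S : System n R) (cfg : ℕ → Config n V R)
    (ev : ℕ → Event n V R) (A : Set (Event n V R)) : Prop :=
  ∀ T, (∀ T', T ≤ T' → ∃ a ∈ A, ∃ c, Step S (cfg T') a c) → ∃ T', T ≤ T' ∧ ev T' ∈ A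

/-- The executions of the algorithm in the asynchronous system `S`. The time of an event is its
position; a run in which nothing more happens is continued by `idle`. -/
structure Execution {n : ℕ} (V : Type v) {R : Type u} (S : System n R) where
  cfg : ℕ → Config n V R
  ev : ℕ → Event n V R
  start : cfg 0 = Config.init n V R
  step : ∀ T, Step S (cfg T) (ev T) (cfg (T + 1))
  /-- reliable delivery between correct processes -/
  reliable : ∀ T p, p ∈ (cfg T).net → Correct S ev p.src → Correct S ev p.dst →
    ∃ T', T ≤ T' ∧ ev T' = .receive p
  /-- first termination property of reliable broadcast -/
  termination_one : Correct S ev .writer → ∀ T, ∀ m ∈ (cfg T).cast, ∀ i,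
    Correct S ev (.server i) → ∃ T', ev T' = .deliver i m
  /-- second termination property of reliable broadcast -/
  termination_two : ∀ T i m, Correct S ev (.server i) → ev T = .deliver i m → ∀ j,
    Correct S ev (.server j) → ∃ T', ev T' = .deliver j m
  fair_answerVal : ∀ i r ts seq, Correct S ev (.server i) →
    WeaklyFair S cfg ev {.answerVal i r ts seq}
  fair_answerBlock : ∀ i x, Correct S ev (.server i) → WeaklyFair S cfg ev {.answerBlock i x}
  fair_requestBlocks : ∀ r, Correct S ev (.reader r) → WeaklyFair S cfg ev {.requestBlocks r}
  fair_returnRead : ∀ r, Correct S ev (.reader r) →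
    WeaklyFair S cfg ev {a | ∃ w, a = .returnRead r w}
  fair_returnWrite : Correct S ev .writer → WeaklyFair S cfg ev {a | ∃ ts, a = .returnWrite ts}
  fair_returnAudit : Correct S ev .writer →
    WeaklyFair S cfg ev {a | ∃ k EA, a = .returnAudit k EA}

variable {n : ℕ} {V : Type v} {R : Type u} {S : System n R}

/-- Before time `T`, reader `r` has effectively read `w`: some `write(w)`, with timestamp `ts` say,
has been invoked and `r` has received from servers `tau` different blocks of it. -/
def Execution.EffectivelyReadBefore (E : Execution V S) (r : R) (w : V) (T : ℕ) : Prop :=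
  ∃ ts, (∃ T₀, T₀ < T ∧ E.ev T₀ = .invokeWrite w ts) ∧
    S.tau ≤ {i : Fin n | ∃ T₁, T₁ < T ∧ ∃ j m, E.ev T₁ = .receive ⟨.server j, .reader r, m⟩ ∧
      Block.share w ts i ∈ m.blocks}.ncard

/-- Reader `r` effectively reads `w` at some time of the execution. -/
def Execution.EffectivelyReads (E : Execution V S) (r : R) (w : V) : Prop :=
  ∃ T, E.EffectivelyReadBefore r w T

/-- The audit response `EA` reports that `r` has read `w`: it contains a record of `r` with the
timestamp of a `write(w)`. -/
def Execution.Reports (E : Execution V S) (EA : Set (Record n R)) (r : R) (w : V) : Prop :=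
  ∃ ts, (∃ T₀, E.ev T₀ = .invokeWrite w ts) ∧ ∃ x ∈ EA, x.reader = r ∧ x.ts = ts

/-- Completeness: a reader, correct or Byzantine, that has effectively read `w` before the
invocation of an audit is reported by it, i.e. its response (which exists unless the
writer crashes) reports the reader. -/
def Execution.Completeness (E : Execution V S) : Prop :=
  ∀ (r : R) (w : V) (T k : ℕ), E.ev T = .invokeAudit k → E.EffectivelyReadBefore r w T →
    (∀ T' EA, E.ev T' = .returnAudit k EA → E.Reports EA r w) ∧
    (Correct S E.ev .writer → ∃ T' EA, T < T' ∧ E.ev T' = .returnAudit k EA)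

/-- Strong accuracy: a correct reader that never effectively reads `w` is not reported by any
audit to have read `w`. -/
def Execution.StrongAccuracy (E : Execution V S) : Prop :=
  ∀ (r : R) (w : V), Correct S E.ev (.reader r) → ¬ E.EffectivelyReads r w →
    ∀ T k EA, E.ev T = .returnAudit k EA → ¬ E.Reports EA r w

def Execution.StrongAuditability (E : Execution V S) : Prop :=
  E.Completeness ∧ E.StrongAccuracy

end AuditableRegister

namespace AuditableRegister

variable {n : ℕ} {V R : Type*} {S : System n R}

/-! Both halves rest on quorum counting over `n = 3f + 1` servers, together with two tracking
invariants: one for genuine blocks, one for signed records.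

Completeness. The `2f + 1` blocks received by the reader and the `n - f = 2f + 1` logs collected by
the audit concern server sets that share at least `f + 1` members, hence a correct server `i`. Block
`i` can be decrypted by `i` alone, and non-cooperation keeps it away from every Byzantine server, so
a reader can get it from a server only as an answer of `i` itself (`share_spec`). Such an answer is
sent in the very step that logs the signed record. Logs only grow, and answers to an audit are
produced after its invocation (`mem_collLog_of_mem_log`), so the record is in the log collected from
`i`; with `t = 1` this one log suffices. A response exists by reliable channels and fairness
(`exists_returnAudit`).

Strong accuracy. Since `t = 1`, a report may come from a single Byzantine server, but the signature
proves that the correct reader really requested the blocks (`unforgeable`). It did so only after `f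
+ 1` servers had vouched for the timestamp, one of them correct. As writes are sequential, some
correct server has then delivered the write (`signed_spec`), and reliable broadcast carries it to
all correct servers even if the writer crashes. Each of them answers the request
(`exists_receive_share`), so the reader does receive `n - f = tau` different blocks.

The first argument needs `tau ≥ 2f + 1`, the second `tau ≤ n - f`; for `n = 3f + 1` these meet
exactly. -/

theorem mem_sendAll {src : Proc n R} {m : Msg n V R} {p : Packet n V R} :
    p ∈ sendAll src m ↔ ∃ i, p = ⟨src, .server i, m⟩ := by
  simp [sendAll, eq_comm]

/-! ### Local transitions -/

@[simp] theorem ServerState.recv_regTs (i : Fin n) (s : ServerState n V R) (src : Proc n R)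
    (m : Msg n V R) : (s.recv i src m).1.regTs = s.regTs := by
  cases src <;> cases m <;> simp only [ServerState.recv]; split_ifs <;> rfl

@[simp] theorem ServerState.recv_val (i : Fin n) (s : ServerState n V R) (src : Proc n R)
    (m : Msg n V R) : (s.recv i src m).1.val = s.val := by
  cases src <;> cases m <;> simp only [ServerState.recv]; split_ifs <;> rfl

@[simp] theorem ServerState.recv_log (i : Fin n) (s : ServerState n V R) (src : Proc n R)
    (m : Msg n V R) : (s.recv i src m).1.log = s.log := by
  cases src <;> cases m <;> simp only [ServerState.recv]; split_ifs <;> rfl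

theorem ServerState.mem_recv_pendingBlock {i : Fin n} {s : ServerState n V R} {src : Proc n R}
    {m : Msg n V R} {x : Record n R} :
    x ∈ (s.recv i src m).1.pendingBlock ↔
      (x ∈ s.pendingBlock ∨ (src = .reader x.reader ∧ m = .blockReq x ∧ x.Valid)) := by
  cases src <;> cases m <;> simp only [ServerState.recv] <;> (try split_ifs) <;> grind

theorem ServerState.mem_recv_packets {i : Fin n} {s : ServerState n V R} {src : Proc n R}
    {m : Msg n V R} {p : Packet n V R} (hp : p ∈ (s.recv i src m).2) :
    (∃ r q, p = ⟨.server i, .reader r, .tsResp s.regTs q⟩) ∨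
      ∃ k, src = .writer ∧ m = .auditReq k ∧ p = ⟨.server i, .writer, .auditResp k s.log⟩ := by
  revert hp
  cases src <;> cases m <;> simp only [ServerState.recv] <;> (try split_ifs) <;> simp
  · exact fun h => ⟨_, _, h⟩
  · exact fun h => .inr h

theorem ReaderState.mem_recv_packets {f : ℕ} {r : R} {s : ReaderState n V} {src : Proc n R}
    {m : Msg n V R} {p : Packet n V R} (hp : p ∈ (s.recv f r src m).2) :
    ∃ i k q, p = ⟨.reader r, .server i, .valReq k q⟩ := by
  revert hp
  cases src <;> cases m <;> simp only [ReaderState.recv] <;> (try split_ifs) <;> (try split) <;>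
    simp [mem_sendAll]
  intro i hi
  exact ⟨i, _, _, hi⟩

theorem ReaderState.mem_recv_collTs {f : ℕ} {r : R} {s : ReaderState n V} {src : Proc n R}
    {m : Msg n V R} {i : Fin n} {k : ℕ} (hk : k ∈ (s.recv f r src m).1.collTs i) :
    k ∈ s.collTs i ∨ (src = .server i ∧ ∃ q, m = .tsResp k q ∨ m = .valResp k q) := by
  revert hk
  cases src <;> cases m <;> simp only [ReaderState.recv] <;> (try split_ifs) <;>
    (try simp only [Function.update_apply]) <;> (try split_ifs) <;> simp_all <;> tauto

@[simp] theorem WriterState.recv_phase (s : WriterState n R) (src : Proc n R) (m : Msg n V R) :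
    (s.recv src m).phase = s.phase := by
  cases src <;> cases m <;> simp only [WriterState.recv] <;> split_ifs <;> rfl

@[simp] theorem WriterState.recv_crashed (s : WriterState n R) (src : Proc n R) (m : Msg n V R) :
    (s.recv src m).crashed = s.crashed := by
  cases src <;> cases m <;> simp only [WriterState.recv] <;> split_ifs <;> rfl

@[simp] theorem WriterState.recv_ts (s : WriterState n R) (src : Proc n R) (m : Msg n V R) :
    (s.recv src m).ts = s.ts := by
  cases src <;> cases m <;> simp only [WriterState.recv] <;> split_ifs <;> rfl

@[simp] theorem WriterState.recv_auditNo (s : WriterState n R) (src : Proc n R) (m : Msg n V R) :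
    (s.recv src m).auditNo = s.auditNo := by
  cases src <;> cases m <;> simp only [WriterState.recv] <;> split_ifs <;> rfl

theorem WriterState.recv_acks {s : WriterState n R} {src : Proc n R} {m : Msg n V R} {i : Fin n}
    {k : ℕ} (h : (s.recv src m).acks i = some k) :
    s.acks i = some k ∨ (src = .server i ∧ m = .writeAck k) := by
  revert h
  cases src <;> cases m <;> simp only [WriterState.recv] <;> (try split_ifs) <;>
    grind [Function.update_apply]

theorem WriterState.recv_collLog {s : WriterState n R} {src : Proc n R} {m : Msg n V R} {i : Fin n}
    {log : Set (Record n R)} (h : (s.recv src m).collLog i = some log) :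
    s.collLog i = some log ∨ (src = .server i ∧ m = .auditResp s.auditNo log) := by
  revert h
  cases src <;> cases m <;> simp only [WriterState.recv] <;> (try split_ifs) <;>
    grind [Function.update_apply]

theorem WriterState.recv_collLog_ne_none {s : WriterState n R} {src : Proc n R} {m : Msg n V R}
    {i : Fin n} (h : s.collLog i ≠ none) : (s.recv src m).collLog i ≠ none := by
  revert h
  cases src <;> cases m <;> simp only [WriterState.recv] <;> (try split_ifs) <;>
    grind [Function.update_apply]

theorem WriterState.recv_auditResp_ne_none {s : WriterState n R} {i : Fin n}
    {log : Set (Record n R)} :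
    (s.recv (.server i) (.auditResp s.auditNo log : Msg n V R)).collLog i ≠ none := by
  simp [WriterState.recv]

/-! ### Monotone parts of the configuration -/

variable {c c' : Config n V R} {a : Event n V R}

theorem Step.cast_mono (h : Step S c a c') : c.cast ⊆ c'.cast := by
  cases h <;> simp

theorem Step.signed_mono (h : Step S c a c') : c.signed ⊆ c'.signed := by
  cases h <;> simp

theorem Step.delivered_mono (h : Step S c a c') (i : Fin n) : c.delivered i ⊆ c'.delivered i := by
  cases h <;> grind [Function.update_apply]

theorem Step.writer_ts_mono (h : Step S c a c') : c.writer.ts ≤ c'.writer.ts := by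
  cases h <;> simp

theorem Step.auditNo_mono (h : Step S c a c') : c.writer.auditNo ≤ c'.writer.auditNo := by
  cases h <;> simp

theorem Step.regTs_mono (h : Step S c a c') (i : Fin n) :
    (c.server i).regTs ≤ (c'.server i).regTs := by
  cases h <;> simp only [Function.update_apply, le_refl] <;>
    grind [ServerState.deliver, ServerState.recv_regTs]

theorem Step.log_mono (h : Step S c a c') (i : Fin n) :
    (c.server i).log ⊆ (c'.server i).log := by
  cases h <;> simp only [Function.update_apply, subset_refl] <;>
    grind [ServerState.deliver, ServerState.recv_log]

/-! ### Parts that change in a single kind of step -/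

theorem Step.mem_cast (h : Step S c a c') {m : WriteMsg n V} (hm : m ∈ c'.cast) :
    m ∈ c.cast ∨ ∃ w, a = .invokeWrite w c'.writer.ts ∧ c'.writer.ts = c.writer.ts + 1 ∧
      m = ⟨c'.writer.ts, generateBlocks w c'.writer.ts⟩ := by
  cases h <;> simp_all [or_comm]

theorem Step.mem_delivered (h : Step S c a c') {i : Fin n} {m : WriteMsg n V}
    (hm : m ∈ c'.delivered i) (hn : m ∉ c.delivered i) :
    a = .deliver i m ∧ m ∈ c.cast ∧ .server i ∉ S.byz ∧
      c'.server i = (c.server i).deliver i m := by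
  cases h <;> grind [Function.update_apply]

/-- The only place where the reader's `f + 1` rule enters the proof. -/
theorem Step.mem_signed (h : Step S c a c') {x : Record n R} (hx : x ∈ c'.signed)
    (hn : x ∉ c.signed) :
    (∀ i, ⟨.reader x.reader, .server i, .blockReq x⟩ ∈ c'.net) ∧
      S.f + 1 ≤ {i | x.ts ∈ (c.reader x.reader).collTs i}.ncard := by
  cases h <;> simp_all [mem_sendAll]

theorem Step.mem_collTs (h : Step S c a c') {r : R} {i : Fin n} {k : ℕ}
    (hk : k ∈ (c'.reader r).collTs i) :
    k ∈ (c.reader r).collTs i ∨ ∃ p ∈ c.net, p.src = .server i ∧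
      ∃ q, p.msg = .tsResp k q ∨ p.msg = .valResp k q := by
  cases h with
  | receiveReader r' src m rest hr hnet =>
    by_cases hrr : r = r'
    · subst hrr
      simp only [Function.update_self] at hk
      rcases ReaderState.mem_recv_collTs hk with h | ⟨h, q, hq⟩
      · exact .inl h
      · exact .inr ⟨_, by rw [hnet]; exact Multiset.mem_cons_self _ _, h, q, hq⟩
    · left; simpa [hrr] using hk
  | _ => grind [Function.update_apply, ReaderState.start]

theorem Step.acks_cases (h : Step S c a c') {i : Fin n} {k : ℕ}
    (hk : c'.writer.acks i = some k) :
    c.writer.acks i = some k ∨ ∃ p ∈ c.net, p.src = .server i ∧ p.msg = .writeAck k := by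
  cases h with
  | receiveWriter src m rest hc hnet =>
    rcases WriterState.recv_acks hk with h | ⟨h, hq⟩
    · exact .inl h
    · exact .inr ⟨_, by rw [hnet]; exact Multiset.mem_cons_self _ _, h, hq⟩
  | _ => exact .inl hk

theorem Step.collLog_cases (h : Step S c a c') {i : Fin n} {log : Set (Record n R)}
    (hk : c'.writer.collLog i = some log) :
    c.writer.collLog i = some log ∨ ∃ p ∈ c.net, p.src = .server i ∧
      p.msg = .auditResp c.writer.auditNo log := by
  cases h with
  | receiveWriter src m rest hc hnet =>
    rcases WriterState.recv_collLog hk with h | ⟨h, hq⟩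
    · exact .inl h
    · exact .inr ⟨_, by rw [hnet]; exact Multiset.mem_cons_self _ _, h, hq⟩
  | invokeAudit => simp at hk
  | _ => exact .inl hk

theorem Step.mem_pendingBlock (h : Step S c a c') {i : Fin n} {x : Record n R}
    (hx : x ∈ (c'.server i).pendingBlock) :
    x ∈ (c.server i).pendingBlock ∨
      (x.Valid ∧ ∃ p ∈ c.net, p.msg = .blockReq x) := by
  cases h with
  | receiveServer j src m rest hi hnet =>
    by_cases hij : i = j
    · subst hij
      simp only [Function.update_self] at hx
      rcases ServerState.mem_recv_pendingBlock.1 hx with h | ⟨-, h, hv⟩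
      · exact .inl h
      · exact .inr ⟨hv, _, by rw [hnet]; exact Multiset.mem_cons_self _ _, h⟩
    · left; simpa [hij] using hx
  | _ => grind [Function.update_apply, ServerState.deliver]

theorem Step.mem_log (h : Step S c a c') {i : Fin n} {x : Record n R}
    (hx : x ∈ (c'.server i).log) :
    x ∈ (c.server i).log ∨ x ∈ (c.server i).pendingBlock := by
  cases h <;> grind [Function.update_apply, ServerState.deliver, ServerState.recv_log]

theorem Step.val_cases (h : Step S c a c') {i : Fin n} {k : ℕ} :
    (c'.server i).val k = (c.server i).val k ∨
      ∃ m ∈ c.cast, m.ts = k ∧ (c'.server i).val k = decrypt i (m.blocks i) := by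
  cases h with
  | deliver j m hi hm hnew =>
    by_cases hij : i = j
    · subst hij
      by_cases hk : k = m.ts
      · subst hk
        exact .inr ⟨m, hm, rfl, by simp [ServerState.deliver]⟩
      · left; simp [ServerState.deliver, hk]
    · left; simp [hij]
  | _ => left; grind [Function.update_apply, ServerState.recv_val]

theorem Step.regTs_cases (h : Step S c a c') {i : Fin n} :
    (c'.server i).regTs = (c.server i).regTs ∨
      ∃ m ∈ c'.delivered i, m.ts = (c'.server i).regTs := by
  cases h <;> grind [Function.update_apply, ServerState.deliver, ServerState.recv_regTs]

open Classical in
theorem Step.mem_received (h : Step S c a c') {p : Proc n R} {b : Block n V}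
    (hb : b ∈ c'.received p) :
    b ∈ c.received p ∨ ∃ q ∈ c.net, q.dst = p ∧ b ∈ q.msg.blocks := by
  have key : ∀ (q : Packet n V R) (d : Proc n R), q ∈ c.net → q.dst = d →
      b ∈ Function.update c.received d (c.received d ∪ q.msg.blocks) p →
      b ∈ c.received p ∨ ∃ q ∈ c.net, q.dst = p ∧ b ∈ q.msg.blocks := by
    intro q d hq hd hb
    by_cases hp : p = d
    · subst hp
      rw [Function.update_self] at hb
      exact hb.imp_right fun h => ⟨q, hq, hd, h⟩
    · rw [Function.update_of_ne hp] at hb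
      exact .inl hb
  cases h with
  | receiveServer _ _ _ _ _ hnet =>
    exact key _ _ (hnet ▸ Multiset.mem_cons_self _ _) rfl (by convert hb)
  | receiveReader _ _ _ _ _ hnet =>
    exact key _ _ (hnet ▸ Multiset.mem_cons_self _ _) rfl (by convert hb)
  | receiveWriter _ _ _ _ hnet =>
    exact key _ _ (hnet ▸ Multiset.mem_cons_self _ _) rfl (by convert hb)
  | receiveByz _ _ _ hnet =>
    exact key _ _ (hnet ▸ Multiset.mem_cons_self _ _) rfl (by convert hb)
  | _ => exact .inl hb

/-! ### New packets -/

/-- The packets that are sent in a step from `c` to `c'`. -/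
inductive Sent (S : System n R) (c c' : Config n V R) : Packet n V R → Prop
  | auditReq (i : Fin n) : Sent S c c' ⟨.writer, .server i, .auditReq c'.writer.auditNo⟩
  | writeAck (i : Fin n) (m : WriteMsg n V) (hm : m ∈ c'.delivered i) :
      Sent S c c' ⟨.server i, .writer, .writeAck m.ts⟩
  | tsReq (r : R) (i : Fin n) (q : ℕ) : Sent S c c' ⟨.reader r, .server i, .tsReq q⟩
  | valReq (r : R) (i : Fin n) (k q : ℕ) : Sent S c c' ⟨.reader r, .server i, .valReq k q⟩
  | blockReq (i : Fin n) (x : Record n R) (hx : x ∈ c'.signed) :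
      Sent S c c' ⟨.reader x.reader, .server i, .blockReq x⟩
  | tsResp (i : Fin n) (r : R) (q : ℕ) :
      Sent S c c' ⟨.server i, .reader r, .tsResp (c.server i).regTs q⟩
  | valResp (i : Fin n) (r : R) (k q : ℕ) (hk : k ≤ (c.server i).regTs) :
      Sent S c c' ⟨.server i, .reader r, .valResp k q⟩
  -- The log is that of the new state: logging and answering are one atomic step, which is what
  -- completeness exploits.
  | blockResp (i : Fin n) (x : Record n R) (hx : x ∈ (c'.server i).log) :
      Sent S c c'
        ⟨.server i, .reader x.reader, .blockResp ((c.server i).val x.ts) x.ts x.seq⟩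
  | auditResp (i : Fin n) (k : ℕ) (hk : ⟨.writer, .server i, .auditReq k⟩ ∈ c.net) :
      Sent S c c' ⟨.server i, .writer, .auditResp k (c.server i).log⟩
  | byz (p : Packet n V R) (hp : ByzCanSend S c p) : Sent S c c' p

/-- Receptions only remove packets, so every invariant about messages in transit reduces to the ten
kinds of `Sent`. Authentication is confined to the `byz` case, whose source is Byzantine. -/
theorem Step.mem_net (h : Step S c a c') {p : Packet n V R} (hp : p ∈ c'.net) :
    p ∈ c.net ∨ Sent S c c' p := by
  cases h with
  | invokeAudit hc hph =>
    rcases Multiset.mem_add.1 hp with h | h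
    · exact .inl h
    · obtain ⟨i, rfl⟩ := mem_sendAll.1 h
      exact .inr (.auditReq i)
  | deliver i m hi hm hnew =>
    rcases Multiset.mem_cons.1 hp with rfl | h
    · exact .inr (.writeAck i m (by simp))
    · exact .inl h
  | invokeRead r hr hph =>
    rcases Multiset.mem_add.1 hp with h | h
    · exact .inl h
    · obtain ⟨i, rfl⟩ := mem_sendAll.1 h
      exact .inr (.tsReq _ _ _)
  | requestBlocks r k hr hph hk hcount =>
    rcases Multiset.mem_add.1 hp with h | h
    · exact .inl h
    · obtain ⟨i, rfl⟩ := mem_sendAll.1 h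
      exact .inr (.blockReq i ⟨r, k, (c.reader r).seq, .reader r⟩ (Set.mem_insert _ _))
  | answerVal i r ts seq rest hi hpend hts =>
    rcases Multiset.mem_cons.1 hp with rfl | h
    · exact .inr (.valResp _ _ _ _ hts)
    · exact .inl h
  | answerBlock i x rest hi hpend hready =>
    rcases Multiset.mem_cons.1 hp with rfl | h
    · exact .inr (.blockResp i x (by simp))
    · exact .inl h
  | receiveServer i src m rest hi hnet =>
    rcases Multiset.mem_add.1 hp with h | h
    · exact .inl (hnet ▸ Multiset.mem_cons_of_mem h)
    · rcases ServerState.mem_recv_packets h with ⟨r, q, rfl⟩ | ⟨k, rfl, rfl, rfl⟩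
      · exact .inr (.tsResp i r q)
      · exact .inr (.auditResp i k (hnet ▸ Multiset.mem_cons_self _ _))
  | receiveReader r src m rest hr hnet =>
    rcases Multiset.mem_add.1 hp with h | h
    · exact .inl (hnet ▸ Multiset.mem_cons_of_mem h)
    · obtain ⟨i, k, q, rfl⟩ := ReaderState.mem_recv_packets h
      exact .inr (.valReq _ _ _ _)
  | receiveWriter src m rest hc hnet => exact .inl (hnet ▸ Multiset.mem_cons_of_mem hp)
  | receiveByz q rest hq hnet => exact .inl (hnet ▸ Multiset.mem_cons_of_mem hp)
  | byzSend q hq =>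
    rcases Multiset.mem_cons.1 hp with rfl | h
    · exact .inr (.byz _ hq)
    · exact .inl h
  | _ => exact .inl hp

/-! ### Decryption, quorums and the phases of the writer -/

theorem decrypt_eq_some_iff {i : Fin n} {e : EncBlock n V} {b : Block n V} :
    decrypt i e = some b ↔ e.key = i ∧ e.block = b := by
  simp [decrypt]

theorem System.exists_correct_mem (S : System n R) {A : Set (Fin n)} (hA : S.f < A.ncard) :
    ∃ i ∈ A, Proc.server i ∉ S.byz := by
  by_contra! h
  exact absurd (Set.ncard_le_ncard (t := {i : Fin n | Proc.server i ∈ S.byz}) h)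
    (not_le.2 (S.byz_servers_le.trans_lt hA))

theorem System.le_ncard_correct (S : System n R) :
    n - S.f ≤ {i : Fin n | Proc.server i ∉ S.byz}.ncard := by
  have h := Set.ncard_add_ncard_compl {i : Fin n | Proc.server i ∈ S.byz}
  have h' := S.byz_servers_le
  rw [Nat.card_eq_fintype_card, Fintype.card_fin, Set.compl_ofPred] at h
  omega

/-- The sequential discipline of the writer: the timestamp grows only from the idle phase, and the
writing phase is left only with a quorum of acknowledgements. -/
theorem Step.writer_cases {c c' : Config n V R} {a : Event n V R} (h : Step S c a c') :
    (c'.writer.ts = c.writer.ts ∧ (c'.writer.phase ≠ .writing → c.writer.phase ≠ .writing ∨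
      n - S.f ≤ {i | c.writer.acks i = some c.writer.ts}.ncard)) ∨
    (c'.writer.ts = c.writer.ts + 1 ∧ c.writer.phase = .idle ∧ c'.writer.phase = .writing) := by
  cases h <;> simp_all

theorem Step.deliver_delivered {c c' : Config n V R} {i : Fin n} {m : WriteMsg n V}
    (h : Step S c (.deliver i m) c') : m ∈ c'.delivered i := by
  cases h; simp

namespace Execution

variable (E : Execution V S)

theorem delivered_mono (i : Fin n) : Monotone fun T => (E.cfg T).delivered i :=
  monotone_nat_of_le_succ fun T => (E.step T).delivered_mono i

theorem cast_mono : Monotone fun T => (E.cfg T).cast :=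
  monotone_nat_of_le_succ fun T => (E.step T).cast_mono

theorem log_mono (i : Fin n) : Monotone fun T => ((E.cfg T).server i).log :=
  monotone_nat_of_le_succ fun T => (E.step T).log_mono i

theorem regTs_mono (i : Fin n) : Monotone fun T => ((E.cfg T).server i).regTs :=
  monotone_nat_of_le_succ fun T => (E.step T).regTs_mono i

theorem auditNo_mono : Monotone fun T => (E.cfg T).writer.auditNo :=
  monotone_nat_of_le_succ fun T => (E.step T).auditNo_mono

/-! ### Writes -/

/-- The bound by the writer's counter makes the timestamp of each new write fresh, whence
`cast_inj`. -/
theorem cast_spec (T : ℕ) : ∀ m ∈ (E.cfg T).cast, 1 ≤ m.ts ∧ m.ts ≤ (E.cfg T).writer.ts ∧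
    ∃ w, m = ⟨m.ts, generateBlocks w m.ts⟩ := by
  induction T with
  | zero => simp [E.start, Config.init]
  | succ T ih =>
    intro m hm
    rcases (E.step T).mem_cast hm with h | ⟨w, -, hts, rfl⟩
    · obtain ⟨h1, h2, h3⟩ := ih m h
      exact ⟨h1, h2.trans (E.step T).writer_ts_mono, h3⟩
    · exact ⟨by simp [hts], le_rfl, w, rfl⟩

theorem cast_inj (T : ℕ) : ∀ m ∈ (E.cfg T).cast, ∀ m' ∈ (E.cfg T).cast, m.ts = m'.ts → m = m' := by
  induction T with
  | zero => simp [E.start, Config.init]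
  | succ T ih =>
    intro m hm m' hm' hts
    rcases (E.step T).mem_cast hm with h | ⟨w, hw, hts, rfl⟩ <;>
      rcases (E.step T).mem_cast hm' with h' | ⟨w', hw', hts', rfl⟩
    · exact ih m h m' h' hts
    · have := (E.cast_spec T m h).2.1
      simp only at hts
      omega
    · have := (E.cast_spec T m' h').2.1
      simp only at hts
      omega
    · obtain ⟨rfl, -⟩ := Event.invokeWrite.inj (hw.symm.trans hw')
      rfl

theorem cast_of_invokeWrite {T ts : ℕ} {w : V} (h : E.ev T = .invokeWrite w ts) :
    ⟨ts, generateBlocks w ts⟩ ∈ (E.cfg (T + 1)).cast := by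
  have hs := E.step T
  rw [h] at hs
  generalize E.cfg T = c, E.cfg (T + 1) = c' at hs
  cases hs
  exact Set.mem_insert _ _

/-- The index `i` is needed to compare the values: with no servers the block families would be equal
for all values. -/
theorem cast_value_unique {T ts : ℕ} {w w' : V} (h : ⟨ts, generateBlocks w ts⟩ ∈ (E.cfg T).cast)
    (h' : ⟨ts, generateBlocks w' ts⟩ ∈ (E.cfg T).cast) (i : Fin n) : w = w' := by
  have := congrFun (WriteMsg.mk.inj (E.cast_inj T _ h _ h' rfl)).2 i
  simp only [generateBlocks, EncBlock.mk.injEq, Block.share.injEq] at this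
  exact this.2.1

/-- Deliveries are recorded for correct servers only, so membership in `delivered i` itself
certifies that server `i` is correct. -/
theorem delivered_spec (T : ℕ) (i : Fin n) : ∀ m ∈ (E.cfg T).delivered i, m ∈ (E.cfg T).cast ∧
    Proc.server i ∉ S.byz ∧ (((E.cfg T).server i).val m.ts).isSome ∧
    m.ts ≤ ((E.cfg T).server i).regTs ∧ ∃ T', E.ev T' = .deliver i m := by
  induction T with
  | zero => simp [E.start, Config.init]
  | succ T ih =>
    intro m hm
    -- A stored block can only be overwritten by that of another broadcast message, which server `i`
    -- can decrypt too; hence `isSome` is stable.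
    have hdec : ∀ m ∈ (E.cfg T).cast, (decrypt i (m.blocks i)).isSome := by
      intro m hm
      obtain ⟨-, -, w, hw⟩ := E.cast_spec T m hm
      rw [hw]
      simp [decrypt, generateBlocks]
    by_cases hold : m ∈ (E.cfg T).delivered i
    · obtain ⟨h1, h2, h3, h4, h5⟩ := ih m hold
      refine ⟨(E.step T).cast_mono h1, h2, ?_, h4.trans ((E.step T).regTs_mono i), h5⟩
      rcases (E.step T).val_cases (i := i) (k := m.ts) with h | ⟨m', hm', -, h⟩
      · rwa [h]
      · rw [h]
        exact hdec m' hm'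
    · obtain ⟨h1, h2, h3, h4⟩ := (E.step T).mem_delivered hm hold
      refine ⟨(E.step T).cast_mono h2, h3, ?_, ?_, T, h1⟩
      · rw [h4]
        simpa [ServerState.deliver] using hdec m h2
      · rw [h4]
        simp only [ServerState.deliver]
        split_ifs <;> omega

theorem val_spec (T : ℕ) (i : Fin n) (k : ℕ) (b : Block n V)
    (h : ((E.cfg T).server i).val k = some b) :
    ∃ w, ⟨k, generateBlocks w k⟩ ∈ (E.cfg T).cast ∧ b = .share w k i := by
  induction T with
  | zero => simp [E.start, Config.init, ServerState.init] at h
  | succ T ih =>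
    rcases (E.step T).val_cases (i := i) (k := k) with h' | ⟨m, hm, rfl, h'⟩
    · obtain ⟨w, hw, hb⟩ := ih (h' ▸ h)
      exact ⟨w, (E.step T).cast_mono hw, hb⟩
    · obtain ⟨-, -, w, hw⟩ := E.cast_spec T m hm
      refine ⟨w, (E.step T).cast_mono (hw ▸ hm), ?_⟩
      rw [h', hw] at h
      simpa [decrypt, generateBlocks, eq_comm] using h

theorem regTs_spec (T : ℕ) (i : Fin n) : ((E.cfg T).server i).regTs = 0 ∨
    ∃ m ∈ (E.cfg T).delivered i, m.ts = ((E.cfg T).server i).regTs := by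
  induction T with
  | zero => simp [E.start, Config.init, ServerState.init]
  | succ T ih =>
    rcases (E.step T).regTs_cases (i := i) with h | h
    · rw [h]
      exact ih.imp_right fun ⟨m, hm, hts⟩ => ⟨m, (E.step T).delivered_mono i hm, hts⟩
    · exact .inr h

/-! ### Messages of correct servers -/

/-- A correct server mentions only timestamps that it has reached, and nobody else can send in its
name; `regTs` never decreases. -/
theorem net_timestamp_le {i : Fin n} (hi : .server i ∉ S.byz) {k q : ℕ} (T : ℕ) :
    ∀ p ∈ (E.cfg T).net, p.src = .server i → p.msg = .tsResp k q ∨ p.msg = .valResp k q →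
      k ≤ ((E.cfg T).server i).regTs := by
  induction T with
  | zero => simp [E.start, Config.init]
  | succ T ih =>
    intro p hp hsrc hmsg
    refine le_trans ?_ ((E.step T).regTs_mono i)
    rcases (E.step T).mem_net hp with h | h
    · exact ih p h hsrc hmsg
    · cases h with
      | byz _ h => exact absurd (hsrc ▸ h.byz) hi
      | _ => simp_all

theorem collTs_le {i : Fin n} (hi : .server i ∉ S.byz) {r : R} {k : ℕ} (T : ℕ) :
    k ∈ ((E.cfg T).reader r).collTs i → k ≤ ((E.cfg T).server i).regTs := by
  induction T with
  | zero => simp [E.start, Config.init, ReaderState.init]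
  | succ T ih =>
    intro hk
    refine le_trans ?_ ((E.step T).regTs_mono i)
    rcases (E.step T).mem_collTs hk with h | ⟨p, hp, hsrc, q, hq⟩
    · exact ih h
    · exact E.net_timestamp_le hi T p hp hsrc hq

theorem net_writeAck {i : Fin n} (hi : .server i ∉ S.byz) {k : ℕ} (T : ℕ) :
    ∀ p ∈ (E.cfg T).net, p.src = .server i → p.msg = .writeAck k →
      ∃ m ∈ (E.cfg T).delivered i, m.ts = k := by
  induction T with
  | zero => simp [E.start, Config.init]
  | succ T ih =>
    intro p hp hsrc hmsg
    rcases (E.step T).mem_net hp with h | h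
    · obtain ⟨m, hm, hts⟩ := ih p h hsrc hmsg
      exact ⟨m, (E.step T).delivered_mono i hm, hts⟩
    · cases h with
      | byz _ h => exact absurd (hsrc ▸ h.byz) hi
      | writeAck j m hm =>
        obtain rfl := Proc.server.inj hsrc
        exact ⟨m, hm, Msg.writeAck.inj hmsg⟩
      | _ => simp_all

theorem acks_spec {i : Fin n} (hi : .server i ∉ S.byz) {k : ℕ} (T : ℕ) :
    (E.cfg T).writer.acks i = some k → ∃ m ∈ (E.cfg T).delivered i, m.ts = k := by
  induction T with
  | zero => simp [E.start, Config.init, WriterState.init]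
  | succ T ih =>
    intro hk
    obtain ⟨m, hm, hts⟩ : ∃ m ∈ (E.cfg T).delivered i, m.ts = k := by
      rcases (E.step T).acks_cases hk with h | ⟨p, hp, hsrc, hq⟩
      · exact ih h
      · exact E.net_writeAck hi T p hp hsrc hq
    exact ⟨m, (E.step T).delivered_mono i hm, hts⟩

/-- The message of every completed write has been delivered by a correct server. -/
theorem exists_delivered_of_completed (hn : n = 3 * S.f + 1) {k : ℕ} (hk : 1 ≤ k) (T : ℕ) :
    k ≤ (E.cfg T).writer.ts → (k < (E.cfg T).writer.ts ∨ (E.cfg T).writer.phase ≠ .writing) →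
      ∃ i, ∃ m ∈ (E.cfg T).delivered i, m.ts = k := by
  induction T with
  | zero =>
    simp only [E.start, Config.init, WriterState.init]
    omega
  | succ T ih =>
    intro hle hph
    suffices ∃ i, ∃ m ∈ (E.cfg T).delivered i, m.ts = k by
      obtain ⟨i, m, hm, hts⟩ := this
      exact ⟨i, m, (E.step T).delivered_mono i hm, hts⟩
    rcases (E.step T).writer_cases with ⟨hts, h⟩ | ⟨hts, hidle, hw⟩
    · rw [hts] at hle hph
      rcases hph with hlt | hph
      · exact ih hle (.inl hlt)
      rcases h hph with h | h
      · exact ih hle (.inr h)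
      rcases hle.lt_or_eq with hlt | rfl
      · exact ih hle (.inl hlt)
      -- The write is just returning: its `n - f = 2f + 1 > f` acknowledgements include one from a
      -- correct server.
      obtain ⟨i, hi, hic⟩ := S.exists_correct_mem (lt_of_lt_of_le (by omega) h)
      exact ⟨i, E.acks_spec hic T hi⟩
    -- A new write has just begun, so `k` is below the new timestamp; the idle phase before the step
    -- means that write `k` was already complete.
    · refine ih ?_ (.inr (by simp [hidle]))
      have := hph.resolve_right (by simp [hw])
      omega

/-! ### Records and signatures -/

theorem valid_of_mem_pendingBlock {i : Fin n} {x : Record n R} (T : ℕ) :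
    x ∈ ((E.cfg T).server i).pendingBlock → x.Valid := by
  induction T with
  | zero => simp [E.start, Config.init, ServerState.init]
  | succ T ih =>
    intro h
    rcases (E.step T).mem_pendingBlock h with h | h
    · exact ih h
    · exact h.1

theorem valid_of_mem_log {i : Fin n} {x : Record n R} (T : ℕ) :
    x ∈ ((E.cfg T).server i).log → x.Valid := by
  induction T with
  | zero => simp [E.start, Config.init, ServerState.init]
  | succ T ih =>
    intro h
    rcases (E.step T).mem_log h with h | h
    · exact ih h
    · exact E.valid_of_mem_pendingBlock T h

/-- Signatures of correct processes are not forged. -/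
theorem unforgeable {x : Record n R} (hx : x.signer ∉ S.byz) (T : ℕ) :
    (∀ p ∈ (E.cfg T).net, x ∈ p.msg.records → x ∈ (E.cfg T).signed) ∧
    (∀ i, x ∈ ((E.cfg T).server i).pendingBlock → x ∈ (E.cfg T).signed) ∧
    (∀ i, x ∈ ((E.cfg T).server i).log → x ∈ (E.cfg T).signed) ∧
    ∀ i log, (E.cfg T).writer.collLog i = some log → x ∈ log → x ∈ (E.cfg T).signed := by
  -- Records circulate from messages to pending requests, to logs, and back into messages and the
  -- collected logs, so the four claims need a common induction.
  induction T with
  | zero => simp [E.start, Config.init, ServerState.init, WriterState.init]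
  | succ T ih =>
    obtain ⟨hnet, hpend, hlog, hcoll⟩ := ih
    have hmono := (E.step T).signed_mono
    refine ⟨fun p hp hxp => ?_, fun i h => hmono ?_, fun i h => hmono ?_,
      fun i log h hxl => hmono ?_⟩
    · rcases (E.step T).mem_net hp with h | h
      · exact hmono (hnet p h hxp)
      · cases h with
        | blockReq i y hy =>
          simp only [Msg.records, Set.mem_singleton_iff] at hxp
          exact hxp ▸ hy
        | auditResp i k hk => exact hmono (hlog i hxp)
        | byz _ h => exact hmono (h.unforgeable x hxp hx)
        | _ => simp [Msg.records] at hxp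
    · rcases (E.step T).mem_pendingBlock h with h | ⟨-, p, hp, hm⟩
      · exact hpend i h
      · exact hnet p hp (by simp [hm, Msg.records])
    · rcases (E.step T).mem_log h with h | h
      · exact hlog i h
      · exact hpend i h
    · rcases (E.step T).collLog_cases h with h | ⟨p, hp, -, hm⟩
      · exact hcoll i log h hxl
      · exact hnet p hp (by simpa [hm, Msg.records] using hxl)

/-- A record signed by a correct reader is sent to all servers, and (for a nonzero timestamp) the
write with its timestamp has been delivered by a correct server. -/
theorem signed_spec (hn : n = 3 * S.f + 1) {x : Record n R} (T : ℕ) (hx : x ∈ (E.cfg T).signed) :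
    (∃ T', ∀ i, ⟨.reader x.reader, .server i, .blockReq x⟩ ∈ (E.cfg T').net) ∧
      (1 ≤ x.ts → ∃ i, ∃ m ∈ (E.cfg T).delivered i, m.ts = x.ts) := by
  induction T with
  | zero => simp [E.start, Config.init] at hx
  | succ T ih =>
    by_cases hold : x ∈ (E.cfg T).signed
    · obtain ⟨h1, h2⟩ := ih hold
      refine ⟨h1, fun hts => ?_⟩
      obtain ⟨i, m, hm, h⟩ := h2 hts
      exact ⟨i, m, (E.step T).delivered_mono i hm, h⟩
    · obtain ⟨h1, h2⟩ := (E.step T).mem_signed hx hold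
      refine ⟨⟨T + 1, h1⟩, fun hts => ?_⟩
      -- Among the `f + 1` servers vouching for the timestamp one is correct, so its `regTs` has
      -- reached `x.ts`.
      obtain ⟨i, hi, hic⟩ := S.exists_correct_mem h2
      have hle := E.collTs_le hic T hi
      suffices ∃ i, ∃ m ∈ (E.cfg T).delivered i, m.ts = x.ts by
        obtain ⟨i, m, hm, hts⟩ := this
        exact ⟨i, m, (E.step T).delivered_mono i hm, hts⟩
      rcases E.regTs_spec T i with h0 | ⟨m, hm, hmts⟩
      · omega
      · have hw := (E.cast_spec T m (E.delivered_spec T i m hm).1).2.1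
        -- Either this server has delivered a later write, and then the write `x.ts` was completed
        -- before that one began, or it has delivered the write `x.ts` itself.
        rcases (hmts ▸ hle).lt_or_eq with hlt | heq
        · exact E.exists_delivered_of_completed hn hts T (by omega) (.inl (by omega))
        · exact ⟨i, m, hm, heq.symm⟩

/-! ### Blocks -/

/-- How a genuine block of a correct server travels. -/
theorem share_spec {i : Fin n} (hi : .server i ∉ S.byz) {w : V} {k : ℕ} (T : ℕ) :
    (∀ p ∈ (E.cfg T).net, Block.share w k i ∈ p.msg.blocks →
      (∃ x ∈ ((E.cfg T).server i).log, p.src = .server i ∧ p.dst = .reader x.reader ∧ x.ts = k) ∨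
      ∃ r, p.src = .reader r ∧ (p.dst ∈ S.byz → p.dst = p.src)) ∧
    ∀ j, .server j ∈ S.byz → Block.share w k i ∉ (E.cfg T).received (.server j) := by
  -- The claims support each other: a Byzantine server cannot send the block because it never
  -- receives it, and it never receives it because no packet in transit brings it there.
  induction T with
  | zero => simp [E.start, Config.init]
  | succ T ih =>
    obtain ⟨hnet, hrec⟩ := ih
    refine ⟨fun p hp hb => ?_, fun j hj hb => ?_⟩
    · rcases (E.step T).mem_net hp with h | h
      · refine (hnet p h hb).imp_left ?_
        rintro ⟨x, hx, h⟩
        exact ⟨x, (E.step T).log_mono i hx, h⟩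
      · cases h with
        | blockResp j x hx =>
          left
          cases hv : ((E.cfg T).server j).val x.ts with
          | none => simp [hv, Msg.blocks] at hb
          | some b =>
            obtain ⟨w', -, rfl⟩ := E.val_spec T j _ _ hv
            simp only [hv, Msg.blocks, Set.mem_singleton_iff, Block.share.injEq] at hb
            obtain ⟨-, rfl, rfl⟩ := hb
            exact ⟨x, hx, rfl, rfl, rfl⟩
        | byz _ h =>
          obtain ⟨src, dst, m⟩ := p
          cases src with
          | writer => exact absurd h.byz S.writer_not_byz
          | reader r =>
            refine .inr ⟨r, rfl, fun hd => ?_⟩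
            by_contra hne
            exact h.no_cooperation ⟨r, rfl⟩ hd hne _ _ _ hb
          | server j =>
            rcases h.holds _ _ _ hb with h' | ⟨j', hj, m', hm', l, hl⟩
            · exact absurd h' (hrec j h.byz)
            · obtain rfl := Proc.server.inj hj
              obtain ⟨-, -, w', hw⟩ := E.cast_spec T m' hm'
              rw [hw] at hl
              -- Block `i` is encrypted for server `i`, so a server that obtains it by decryption is
              -- the correct server `i`.
              obtain ⟨hlj, hl⟩ := decrypt_eq_some_iff.1 hl
              obtain ⟨-, -, rfl⟩ := Block.share.inj hl
              exact absurd h.byz (hlj ▸ hi)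
        | _ => simp [Msg.blocks] at hb
    · rcases (E.step T).mem_received hb with h | ⟨p, hp, hd, hb⟩
      · exact hrec j hj h
      · rcases hnet p hp hb with ⟨x, -, -, h, -⟩ | ⟨r, hr, h⟩
        · simp [hd] at h
        · rw [hr, hd] at h
          exact nomatch h hj

/-! ### Audits -/

/-- Audit numbers serve as freshness stamps: before audit `k` is invoked no request numbered `k` is
in transit, hence no answer of a correct server to it either. -/
theorem net_auditReq_le {k : ℕ} (T : ℕ) : ∀ p ∈ (E.cfg T).net, p.src = .writer →
    p.msg = .auditReq k → k ≤ (E.cfg T).writer.auditNo := by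
  induction T with
  | zero => simp [E.start, Config.init]
  | succ T ih =>
    intro p hp hsrc hmsg
    rcases (E.step T).mem_net hp with h | h
    · exact (ih p h hsrc hmsg).trans (E.step T).auditNo_mono
    · cases h with
      | byz _ h => exact absurd (hsrc ▸ h.byz) S.writer_not_byz
      | auditReq i => exact (Msg.auditReq.inj hmsg).ge
      | _ => simp_all

theorem net_auditResp_le {i : Fin n} (hi : .server i ∉ S.byz) {k : ℕ} {log : Set (Record n R)}
    (T : ℕ) : ∀ p ∈ (E.cfg T).net, p.src = .server i →
    p.msg = .auditResp k log → k ≤ (E.cfg T).writer.auditNo := by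
  induction T with
  | zero => simp [E.start, Config.init]
  | succ T ih =>
    intro p hp hsrc hmsg
    refine le_trans ?_ (E.step T).auditNo_mono
    rcases (E.step T).mem_net hp with h | h
    · exact ih p h hsrc hmsg
    · cases h with
      | byz _ h => exact absurd (hsrc ▸ h.byz) hi
      | auditResp j k' hk =>
        obtain ⟨rfl, -⟩ := Msg.auditResp.inj hmsg
        exact E.net_auditReq_le T _ hk rfl rfl
      | _ => simp_all

end Execution

/-! ### Steps with a known event -/

theorem Step.invokeAudit_spec {k : ℕ} (h : Step S c (.invokeAudit k) c') :
    k = c.writer.auditNo + 1 ∧ c'.writer.auditNo = k ∧ c'.writer.phase = .auditing ∧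
      (∀ i, c'.writer.collLog i = none) ∧
      ∀ i, ⟨.writer, .server i, .auditReq k⟩ ∈ c'.net := by
  cases h; simp [mem_sendAll]

theorem Step.returnAudit_spec {k : ℕ} {EA : Set (Record n R)} (h : Step S c (.returnAudit k EA) c') :
    k = c.writer.auditNo ∧ EA = auditResult S.t c.writer.collLog ∧
      n - S.f ≤ {i | c.writer.collLog i ≠ none}.ncard := by
  cases h; simp_all

theorem Step.mem_net_of_receive {p : Packet n V R} (h : Step S c (.receive p) c') : p ∈ c.net := by
  cases h <;> simp_all

theorem Step.receive_server {i : Fin n} (hi : .server i ∉ S.byz) {src : Proc n R} {m : Msg n V R}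
    (h : Step S c (.receive ⟨src, .server i, m⟩) c') :
    c'.server i = ((c.server i).recv i src m).1 ∧
      ∀ p ∈ ((c.server i).recv i src m).2, p ∈ c'.net := by
  cases h with
  | receiveServer => exact ⟨Function.update_self .., fun p hp => Multiset.mem_add.2 (.inr hp)⟩
  | receiveByz _ _ hp => exact absurd hp hi

theorem Step.receive_writer {src : Proc n R} {m : Msg n V R}
    (h : Step S c (.receive ⟨src, .writer, m⟩) c') : c'.writer = c.writer.recv src m := by
  cases h with
  | receiveWriter => rfl
  | receiveByz _ _ hp => exact absurd hp S.writer_not_byz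

theorem Step.crashed (h : Step S c a c') (hc : c'.writer.crashed) : c.writer.crashed ∨ a = .crash := by
  cases h <;> simp_all

/-- For liveness: until an audit returns it stays open and loses no collected log, so the fairness
condition, once enabled, remains so. -/
theorem Step.auditing (h : Step S c a c') (hc : c.writer.phase = .auditing) :
    (∃ EA, a = .returnAudit c.writer.auditNo EA) ∨
      (c'.writer.phase = .auditing ∧ c'.writer.auditNo = c.writer.auditNo ∧
        ∀ i, c.writer.collLog i ≠ none → c'.writer.collLog i ≠ none) := by
  cases h with
  | receiveWriter =>
    exact .inr ⟨by simpa, by simp, fun i hi => WriterState.recv_collLog_ne_none hi⟩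
  | _ => simp_all

theorem Step.pendingBlock_persists (h : Step S c a c') {i : Fin n} {x : Record n R}
    (hx : x ∈ (c.server i).pendingBlock) :
    a = .answerBlock i x ∨ x ∈ (c'.server i).pendingBlock := by
  cases h with
  | receiveServer =>
    right
    simp only [Function.update_apply]
    split_ifs with hij
    · subst hij
      exact ServerState.mem_recv_pendingBlock.2 (.inl hx)
    · exact hx
  | _ => grind [ServerState.deliver, Function.update_apply]

theorem Step.answerBlock_spec {i : Fin n} {x : Record n R} (h : Step S c (.answerBlock i x) c') :
    (c.server i).Ready x.ts ∧
      ⟨.server i, .reader x.reader, .blockResp ((c.server i).val x.ts) x.ts x.seq⟩ ∈ c'.net := by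
  cases h with
  | answerBlock _ _ _ _ _ hready => exact ⟨hready, Multiset.mem_cons_self _ _⟩

theorem correct_server {i : Fin n} (hi : .server i ∉ S.byz) (ev : ℕ → Event n V R) :
    Correct S ev (.server i) := ⟨hi, by simp⟩

namespace Execution

variable (E : Execution V S)

theorem step_of {T : ℕ} {a : Event n V R} (h : E.ev T = a) :
    Step S (E.cfg T) a (E.cfg (T + 1)) := h ▸ E.step T

/-! ### Completeness -/

/-- What a correct server has logged before an audit is in the log that this audit collects. -/
theorem mem_collLog_of_mem_log {i : Fin n} (hi : .server i ∉ S.byz) {x : Record n R} {T k : ℕ}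
    (hT : E.ev T = .invokeAudit k) (hx : x ∈ ((E.cfg T).server i).log) {T' : ℕ} (hT' : T + 1 ≤ T') :
    (∀ p ∈ (E.cfg T').net, p.src = .server i → ∀ k' log, p.msg = .auditResp k' log → k ≤ k' →
      x ∈ log) ∧
    ∀ log, (E.cfg T').writer.collLog i = some log → x ∈ log := by
  have hspec := (E.step_of hT).invokeAudit_spec
  have hsent : ∀ T' ≥ T, ∀ p, Sent S (E.cfg T') (E.cfg (T' + 1)) p → p.src = .server i →
      ∀ k' log, p.msg = .auditResp k' log → x ∈ log := by
    intro T' hT' p h hsrc k' log hmsg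
    cases h with
    | byz _ h => exact absurd (hsrc ▸ h.byz) hi
    | auditResp j _ _ =>
      obtain rfl := Proc.server.inj hsrc
      obtain ⟨-, rfl⟩ := Msg.auditResp.inj hmsg
      exact E.log_mono j hT' hx
    | _ => simp_all
  induction T', hT' using Nat.le_induction with
  | base =>
    refine ⟨fun p hp hsrc k' log hmsg hk => ?_, fun log h => by simp [hspec.2.2.2.1] at h⟩
    rcases (E.step T).mem_net hp with h | h
    -- Answers already in transit at the invocation carry a number below `k`.
    · have := E.net_auditResp_le hi T p h hsrc hmsg
      omega
    · exact hsent T le_rfl p h hsrc k' log hmsg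
  | succ T' hT' ih =>
    obtain ⟨hnet, hcoll⟩ := ih
    refine ⟨fun p hp hsrc k' log hmsg hk => ?_, fun log h => ?_⟩
    · rcases (E.step T').mem_net hp with h | h
      · exact hnet p h hsrc k' log hmsg hk
      · exact hsent T' (by omega) p h hsrc k' log hmsg
    · rcases (E.step T').collLog_cases h with h | ⟨p, hp, hsrc, hm⟩
      · exact hcoll log h
      · exact hnet p hp hsrc _ _ hm (hspec.2.1 ▸ E.auditNo_mono hT')

theorem reports_of_effectivelyReadBefore (hn : n = 3 * S.f + 1) (htau : S.tau = 2 * S.f + 1)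
    (ht : S.t = 1) {r : R} {w : V} {T T' k : ℕ} {EA : Set (Record n R)}
    (hT : E.ev T = .invokeAudit k) (hread : E.EffectivelyReadBefore r w T)
    (hT' : E.ev T' = .returnAudit k EA) : E.Reports EA r w := by
  obtain ⟨ts, ⟨T₀, -, hw⟩, hA⟩ := hread
  have hinv := (E.step_of hT).invokeAudit_spec
  obtain ⟨hk, hEA, hB⟩ := (E.step_of hT').returnAudit_spec
  -- Up to time `T` the audit counter is at most `k - 1`, so the response `k` comes later.
  have hlt : T + 1 ≤ T' := by
    by_contra! h
    have := E.auditNo_mono (Nat.le_of_lt_succ h)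
    simp only at this
    omega
  set A := {i : Fin n | ∃ T₁, T₁ < T ∧ ∃ j m, E.ev T₁ = .receive ⟨.server j, .reader r, m⟩ ∧
      Block.share w ts i ∈ m.blocks} with hAdef
  set B := {i | (E.cfg T').writer.collLog i ≠ none} with hBdef
  -- `(2f + 1) + (2f + 1) - (3f + 1) = f + 1`.
  have hAB : S.f < (A ∩ B).ncard := by
    have h1 := Set.ncard_inter_add_ncard_union A B
    have h2 := Set.ncard_le_card (A ∪ B)
    rw [Nat.card_eq_fintype_card, Fintype.card_fin] at h2
    omega
  obtain ⟨i, ⟨⟨T₁, hT₁, j, m, hrecv, hm⟩, hiB⟩, hi⟩ := S.exists_correct_mem hAB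
  have hp := (E.step_of hrecv).mem_net_of_receive
  rcases (E.share_spec hi T₁).1 _ hp hm with ⟨x, hx, -, hdst, hts⟩ | ⟨r', hr', -⟩
  · obtain ⟨log, hlog⟩ := Option.ne_none_iff_exists'.1 hiB
    have hxlog := (E.mem_collLog_of_mem_log hi hT (E.log_mono i hT₁.le hx) hlt).2 log hlog
    refine ⟨ts, ⟨T₀, hw⟩, x, ?_, (Proc.reader.inj hdst).symm, hts⟩
    rw [hEA, ht]
    exact ⟨E.valid_of_mem_log T₁ hx, (Set.ncard_pos (Set.toFinite _)).2 ⟨i, log, hlog, hxlog⟩⟩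
  -- A block passed on by a reader does not count, since the packet came from a server.
  · simp at hr'

theorem not_crashed (h : ∀ T, E.ev T ≠ .crash) (T : ℕ) : ¬ (E.cfg T).writer.crashed := by
  induction T with
  | zero => simp [E.start, Config.init, WriterState.init]
  | succ T ih => exact fun hc => ((E.step T).crashed hc).elim ih (h T)

theorem exists_returnAudit (hw : Correct S E.ev .writer) {T k : ℕ} (hT : E.ev T = .invokeAudit k) :
    ∃ T' EA, T < T' ∧ E.ev T' = .returnAudit k EA := by
  by_contra! hno
  obtain ⟨-, hk, hph, -, hreq⟩ := (E.step_of hT).invokeAudit_spec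
  have haud : ∀ T', T + 1 ≤ T' →
      (E.cfg T').writer.phase = .auditing ∧ (E.cfg T').writer.auditNo = k := by
    intro T' hT'
    induction T', hT' using Nat.le_induction with
    | base => exact ⟨hph, hk⟩
    | succ T' hT' ih =>
      rcases (E.step T').auditing ih.1 with ⟨EA, h⟩ | ⟨h1, h2, -⟩
      · exact absurd (ih.2 ▸ h) (hno T' EA hT')
      · exact ⟨h1, h2.trans ih.2⟩
  have hcoll : ∀ i, .server i ∉ S.byz →
      ∀ᶠ T' in Filter.atTop, (E.cfg T').writer.collLog i ≠ none := by
    intro i hi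
    obtain ⟨T₁, hT₁, h₁⟩ := E.reliable _ _ (hreq i) hw (correct_server hi _)
    obtain ⟨T₂, hT₂, h₂⟩ := E.reliable (T₁ + 1)
      ⟨.server i, .writer, .auditResp k ((E.cfg T₁).server i).log⟩
      (((E.step_of h₁).receive_server hi).2 _ (by simp [ServerState.recv]))
      (correct_server hi _) hw
    refine Filter.eventually_atTop.2 ⟨T₂ + 1, fun T' hT' => ?_⟩
    induction T', hT' using Nat.le_induction with
    | base =>
      rw [(E.step_of h₂).receive_writer, ← (haud T₂ (by omega)).2]
      exact WriterState.recv_auditResp_ne_none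
    | succ T' hT' ih =>
      rcases (E.step T').auditing (haud T' (by omega)).1 with ⟨EA, h⟩ | ⟨-, -, h⟩
      · exact absurd ((haud T' (by omega)).2 ▸ h) (hno T' EA (by omega))
      · exact h i ih
  -- There are finitely many servers, so from a common time on the logs of all correct ones have
  -- been collected and the response is continuously enabled.
  obtain ⟨N, hN⟩ := Filter.eventually_atTop.1
    (Filter.eventually_all.2 fun i => Filter.eventually_imp_distrib_left.2 (hcoll i))
  obtain ⟨T', hT', k', EA, h⟩ := E.fair_returnAudit hw (max N (T + 1)) fun T' hT' =>
    ⟨_, ⟨_, _, rfl⟩, _, .returnAudit _ (E.not_crashed (hw.2 rfl) T')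
      (haud T' (le_of_max_le_right hT')).1
      (S.le_ncard_correct.trans
        (Set.ncard_le_ncard fun i hi => hN T' (le_of_max_le_left hT') i hi))⟩
  have hT'' := le_of_max_le_right hT'
  have hk' := (E.step_of h).returnAudit_spec.1
  exact hno T' EA hT'' (by rw [h, hk', (haud T' hT'').2])

theorem completeness (hn : n = 3 * S.f + 1) (htau : S.tau = 2 * S.f + 1) (ht : S.t = 1) :
    E.Completeness := fun _ _ _ _ hT hread =>
  ⟨fun _ _ hT' => E.reports_of_effectivelyReadBefore hn htau ht hT hread hT',
    fun hw => E.exists_returnAudit hw hT⟩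

/-! ### Strong accuracy -/

/-- A correct server answers every valid block request for a timestamp that it has delivered. -/
theorem exists_answerBlock {i : Fin n} (hi : .server i ∉ S.byz) {x : Record n R} {T T' : ℕ}
    {m : WriteMsg n V} (hm : m ∈ (E.cfg T).delivered i) (hts : m.ts = x.ts)
    (hx : x ∈ ((E.cfg T').server i).pendingBlock) : ∃ T₁, E.ev T₁ = .answerBlock i x := by
  by_contra! hno
  have hpend : ∀ T₁ ≥ T', x ∈ ((E.cfg T₁).server i).pendingBlock := by
    intro T₁ hT₁
    induction T₁, hT₁ using Nat.le_induction with
    | base => exact hx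
    | succ T₁ _ ih => exact ((E.step T₁).pendingBlock_persists ih).resolve_left (hno T₁)
  -- From `max T T'` on the request is pending and the write delivered; both persist, so weak
  -- fairness applies.
  obtain ⟨T₁, -, h⟩ := E.fair_answerBlock i x (correct_server hi _) (max T T') fun T₁ hT₁ => by
    obtain ⟨rest, hrest⟩ := Multiset.exists_cons_of_mem (hpend T₁ (le_of_max_le_right hT₁))
    obtain ⟨-, -, h1, h2, -⟩ :=
      E.delivered_spec T₁ i m (E.delivered_mono i (le_of_max_le_left hT₁) hm)
    exact ⟨_, rfl, _, .answerBlock _ i x rest hi hrest ⟨hts ▸ h2, .inr (hts ▸ h1)⟩⟩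
  exact hno T₁ h

/-- A correct reader whose request for the blocks of a write has been signed receives the block of
every correct server. -/
theorem exists_receive_share (hn : n = 3 * S.f + 1) {x : Record n R} (hv : x.Valid)
    (hr : .reader x.reader ∉ S.byz) {T T₀ : ℕ} {w : V} (hx : x ∈ (E.cfg T).signed)
    (hw : E.ev T₀ = .invokeWrite w x.ts) {j : Fin n} (hj : .server j ∉ S.byz) :
    ∃ T₁ m, E.ev T₁ = .receive ⟨.server j, .reader x.reader, m⟩ ∧
      Block.share w x.ts j ∈ m.blocks := by
  have hrc : Correct S E.ev (.reader x.reader) := ⟨hr, by simp⟩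
  have hcast := E.cast_of_invokeWrite hw
  have hts := (E.cast_spec _ _ hcast).1
  obtain ⟨⟨T₁, hsent⟩, hdel⟩ := E.signed_spec hn T hx
  obtain ⟨i, m, hm, hmts⟩ := hdel hts
  obtain ⟨-, hi, -, -, T₂, hT₂⟩ := E.delivered_spec T i m hm
  -- The writer may have crashed, so delivery is derived from that at the correct server `i`.
  obtain ⟨T₃, hT₃⟩ := E.termination_two T₂ i m (correct_server hi _) hT₂ j (correct_server hj _)
  obtain ⟨T₄, -, hT₄⟩ := E.reliable _ _ (hsent j) hrc (correct_server hj _)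
  obtain ⟨T₅, hT₅⟩ := E.exists_answerBlock hj (E.step_of hT₃).deliver_delivered hmts (x := x)
    (T' := T₄ + 1) (by
      rw [((E.step_of hT₄).receive_server hj).1]
      exact ServerState.mem_recv_pendingBlock.2 (.inr ⟨rfl, rfl, hv⟩))
  obtain ⟨⟨-, hready⟩, hnet⟩ := (E.step_of hT₅).answerBlock_spec
  -- Written timestamps are at least `1`, which excludes the empty answer allowed for timestamp `0`.
  obtain ⟨b, hb⟩ := Option.isSome_iff_exists.1 (hready.resolve_left (by simp only at hts; omega))
  obtain ⟨w', hw', rfl⟩ := E.val_spec T₅ j _ b hb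
  obtain rfl := E.cast_value_unique (E.cast_mono (le_max_left _ _) hcast)
    (E.cast_mono (le_max_right _ _) hw') j
  obtain ⟨T₆, -, hT₆⟩ := E.reliable _ _ hnet (correct_server hj _) hrc
  exact ⟨T₆, _, hT₆, by simp [hb, Msg.blocks]⟩

theorem strongAccuracy (hn : n = 3 * S.f + 1) (htau : S.tau = 2 * S.f + 1) (ht : S.t = 1) :
    E.StrongAccuracy := by
  rintro r w hr hnot T k EA hT ⟨ts, ⟨T₀, hw⟩, x, hx, rfl, rfl⟩
  rw [(E.step_of hT).returnAudit_spec.2.1, ht] at hx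
  obtain ⟨hv, hcount⟩ := hx
  obtain ⟨l, log, hlog, hxlog⟩ := (Set.ncard_pos (Set.toFinite _)).1 hcount
  -- Server `l` may be Byzantine; the signature of the correct reader is what makes its log
  -- trustworthy here.
  have hsigned := (E.unforgeable (by rw [hv]; exact hr.1) T).2.2.2 l log hlog hxlog
  have hev : ∀ j, .server j ∉ S.byz → ∀ᶠ N in Filter.atTop, ∃ T₁, T₁ < N ∧ ∃ j' m,
      E.ev T₁ = .receive ⟨.server j', .reader x.reader, m⟩ ∧
      Block.share w x.ts j ∈ m.blocks := by
    intro j hj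
    obtain ⟨T₁, m, h⟩ := E.exists_receive_share hn hv hr.1 hsigned hw hj
    exact (Filter.eventually_gt_atTop T₁).mono fun N hN => ⟨T₁, hN, j, m, h⟩
  -- A single time by which the blocks of all correct servers have arrived and the write has been
  -- invoked.
  obtain ⟨N, hN, hN₀⟩ := ((Filter.eventually_all.2 fun j =>
    Filter.eventually_imp_distrib_left.2 (hev j)).and (Filter.eventually_gt_atTop T₀)).exists
  refine hnot ⟨N, x.ts, ⟨T₀, hN₀, hw⟩, ?_⟩
  calc S.tau ≤ n - S.f := by omega
    _ ≤ _ := S.le_ncard_correct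
    _ ≤ _ := Set.ncard_le_ncard fun j hj => hN j hj

end Execution

end AuditableRegister

theorem mainTheorem2 {n : ℕ} {V R : Type*} (S : AuditableRegister.System n R)
    (hn : n = 3 * S.f + 1) (htau : S.tau = 2 * S.f + 1) (ht : S.t = 1)
    (E : AuditableRegister.Execution V S) : E.StrongAuditability :=
  ⟨E.completeness hn htau ht, E.strongAccuracy hn htau ht⟩
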